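/- **Setting.** Let $k\ge 1$, $n\ge 0$, $\tau\in(0,1/2]$, let $\mathcal X$ be a measurable space and $\mathcal Y$ a finite set. For $z\in\{-1,1\}^k$ let $z^{\oplus i}$ denote $z$ with the sign of its $i$-th coordinate flipped, and let $\{p_z : z\in\{-1,1\}^k\}$ be probability distributions on $\mathcal X$. A channel for player $t\in\{1,\dots,n\}$ is a Markov kernel $W(\cdot\mid x,y_1,\dots,y_{t-1})$ from $\mathcal X\times\mathcal Y^{t-1}$ to $\mathcal Y$; for each $t$ let $\mathcal W_t$ be an arbitrary set of such channels. A *sequentially interactive protocol* using $(\mathcal W_1,\dots,\mathcal W_n)$ consists of mutually independent random variables $U$ (public randomness) and $U_1,\dots,U_n$ (private randomness), independent of the samples $X_1,\dots,X_n$, and of (jointly measurable) maps $g_t:(U,U_t)\mapsto W_t\in\mathcal W_t$. For $t=1,\dots,n$ in turn, player $t$ draws the message $Y_t$ from $W_t(\cdot\mid X_t,Y_1,\dots,Y_{t-1})$. The transcript is $(Y^n,U)$ with $Y^n=(Y_1,\dots,Y_n)$. Let $p_z^{Y^n}$ and $p_z^{(Y^n,U)}$ be the laws of the messages and of the transcript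 when $X_1,\dots,X_n$ are i.i.d. with law $p_z$. Let $Z=(Z_1,\dots,Z_k)$ have independent coordinates with $\Pr[Z_i=1]=\tau$ and $\Pr[Z_i=-1]=1-\tau$. Put $p_{\pm i}^{Y^n}=\mathbb E[p_Z^{Y^n}\mid Z_i=\pm1]$ and $p_{\pm i}^{(Y^n,U)}=\mathbb E[p_Z^{(Y^n,U)}\mid Z_i=\pm1]$, and let $d_{TV}(\mu,\nu)=\sup_A|\mu(A)-\nu(A)|$. **Assumptions.** (A1) There are a real $\alpha$, measurable functions $\phi_{z,i}:\mathcal X\to\mathbb R$ and reals $\alpha_{z,i}$ with $|\alpha_{z,i}|\le\alpha$ such that, for all $z$ and $i$, $p_{z^{\oplus i}}\ll p_z$ and $\frac{dp_{z^{\oplus i}}}{dp_z}=1+\alpha_{z,i}\phi_{z,i}$ ($p_z$-almost everywhere). (A2) For all $z$ and all $i,j$, $\mathbb E_{p_z}[\phi_{z,i}\phi_{z,j}]=\mathbf 1[i=j]$. **Corollary (Communication constraints).** Under (A1) and (A2), for every such protocol, $$\Big(\frac1k\sum_{i=1}^k d_{TV}\big(p_{+i}^{Y^n},p_{-i}^{Y^n}\big)\Big)^2\le\frac7k\,n\,\alpha^2\,|\mathcal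 Y| .$$ If moreover $\sigma\ge0$ is such that, for every $z$ and $X\sim p_z$, the random vector $(\phi_{z,i}(X))_{i\le k}$ has independent coordinates and is $\sigma^2$-subgaussian (that is, for every Euclidean unit vector $v$, the variable $S_v=\sum_i v_i\phi_{z,i}(X)$ satisfies $\mathbb E[S_v]=0$ and $\mathbb E[e^{\lambda S_v}]\le e^{\sigma^2\lambda^2/2}$ for all $\lambda\in\mathbb R$), then $$\Big(\frac1k\sum_{i=1}^k d_{TV}\big(p_{+i}^{Y^n},p_{-i}^{Y^n}\big)\Big)^2\le\frac{14\ln2}{k}\,n\,\alpha^2\sigma^2\log_2|\mathcal Y| .$$ Both bounds also hold with the transcript laws $p_{\pm i}^{(Y^n,U)}$ in place of the message laws $p_{\pm i}^{Y^n}$. -/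

import Mathlib

open MeasureTheory ProbabilityTheory
open scoped ENNReal NNReal

noncomputable section

/-- Total variation distance `sup_A |μ(A) - ν(A)|`, over measurable `A`, of two probability
measures. -/
def tvDist {Ω : Type*} [MeasurableSpace Ω] (μ ν : Measure Ω) : ℝ :=
  ⨆ A : {A : Set Ω // MeasurableSet A}, |μ.real A.1 - ν.real A.1|

/-! ### The perturbation space `{-1, 1}^k` -/

/-- The perturbation space `{-1, 1}^k` (`ℤˣ` is the two-element set `{1, -1}`). -/
abbrev Cube (k : ℕ) : Type := Fin k → ℤˣ

instance instDiscreteMeasurableSpaceSign : DiscreteMeasurableSpace ℤˣ :=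
  ⟨fun s => ⟨Units.val '' s, MeasurableSet.of_discrete,
    Set.preimage_image_eq s Units.val_injective⟩⟩

/-- Flip the sign of the `i`-th coordinate of `z`. -/
def flipSign {k : ℕ} (z : Cube k) (i : Fin k) : Cube k := Function.update z i (-z i)

/-- The law on `{-1, 1}` giving mass `τ` to `1` and mass `1 - τ` to `-1`. -/
def rademacher (τ : ℝ) : Measure ℤˣ :=
  ENNReal.ofReal τ • Measure.dirac 1 + ENNReal.ofReal (1 - τ) • Measure.dirac (-1)

instance rademacher.instSigmaFinite (τ : ℝ) : SigmaFinite (rademacher τ) := by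
  have : IsFiniteMeasure (rademacher τ) := by
    constructor
    simp [rademacher, ENNReal.add_lt_top]
  infer_instance

/-- The law of `Z = (Z_1, …, Z_k)` with independent coordinates, `Pr[Z_i = 1] = τ`. -/
def rademacherPow (k : ℕ) (τ : ℝ) : Measure (Cube k) := Measure.pi fun _ => rademacher τ

/-- The conditional mixture `E[Q_Z ∣ Z_i = s]` where `Z` has law `rademacherPow k τ`. -/
def condMixture {k : ℕ} {Ω : Type*} [MeasurableSpace Ω] (τ : ℝ) (Q : Cube k → Measure Ω)
    (i : Fin k) (s : ℤˣ) : Measure Ω :=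
  ∑ z : Cube k, ((rademacherPow k τ)[|{z' : Cube k | z' i = s}]) {z} • Q z

/-- The average discrepancy
`(1/k) ∑ i, d_TV(E[Q_Z ∣ Z_i = 1], E[Q_Z ∣ Z_i = -1])`. -/
def avgDiscrepancy {k : ℕ} {Ω : Type*} [MeasurableSpace Ω] (τ : ℝ) (Q : Cube k → Measure Ω) : ℝ :=
  (1 / (k : ℝ)) * ∑ i : Fin k, tvDist (condMixture τ Q i 1) (condMixture τ Q i (-1))

/-! ### Assumptions on the family `p_z` -/

/-- For all `z, i`: `p_{z^{⊕i}} ≪ p_z`, `φ_{z,i}` is measurable, and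
`dp_{z^{⊕i}}/dp_z = 1 + α_{z,i} φ_{z,i}` (`p_z`-a.e.) for some real `|α_{z,i}| ≤ α`. -/
def DensitiesExist {X : Type*} [MeasurableSpace X] {k : ℕ} (p : Cube k → Measure X) (α : ℝ)
    (φ : Cube k → Fin k → X → ℝ) : Prop :=
  ∀ (z : Cube k) (i : Fin k), p (flipSign z i) ≪ p z ∧ Measurable (φ z i) ∧
    ∃ a : ℝ, |a| ≤ α ∧
      (fun x => ((p (flipSign z i)).rnDeriv (p z) x).toReal) =ᵐ[p z] fun x => 1 + a * φ z i x

/-- `E_{p_z}[φ_{z,i} φ_{z,j}] = 1` if `i = j` and `0` otherwise. -/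
def OrthonormalPerturbations {X : Type*} [MeasurableSpace X] {k : ℕ} (p : Cube k → Measure X)
    (φ : Cube k → Fin k → X → ℝ) : Prop :=
  ∀ (z : Cube k) (i j : Fin k), ∫ x, φ z i x * φ z j x ∂(p z) = if i = j then 1 else 0

/-- A real random variable is `c`-subgaussian: `E[Y] = 0` and
`E[e^{λY}] ≤ e^{c λ² / 2}` (in particular finite) for all real `λ`. -/
def IsSubgaussian {Ω : Type*} [MeasurableSpace Ω] (μ : Measure Ω) (Y : Ω → ℝ) (c : ℝ≥0) : Prop :=
  Integrable Y μ ∧ ∫ ω, Y ω ∂μ = 0 ∧ HasSubgaussianMGF Y c μ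

/-- Under every `p_z`, the random vector `(φ_{z,i}(X))_i` is `σ²`-subgaussian (every projection on
a Euclidean unit vector is) and has independent coordinates. -/
def SubgaussianIndep {X : Type*} [MeasurableSpace X] {k : ℕ} (p : Cube k → Measure X)
    (φ : Cube k → Fin k → X → ℝ) (σ : ℝ≥0) : Prop :=
  ∀ z : Cube k,
    (∀ v : EuclideanSpace ℝ (Fin k), ‖v‖ = 1 →
      IsSubgaussian (p z) (fun x => ∑ i, v i * φ z i x) (σ ^ 2)) ∧
    iIndepFun (φ z) (p z)

/-! ### Channels and sequentially interactive protocols -/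

/-- A channel available to the player who speaks after `t` earlier messages: a Markov kernel with
input the player's sample and these messages, and output in `Y`. -/
abbrev Channel (X Y : Type*) [MeasurableSpace X] [MeasurableSpace Y] (t : ℕ) :=
  {W : Kernel (X × (Fin t → Y)) Y // IsMarkovKernel W}

/-- The first `t` messages of `y`. -/
def messagePrefix {Y : Type*} {n : ℕ} (y : Fin n → Y) (t : Fin n) : Fin (t : ℕ) → Y :=
  fun s => y (Fin.castLE t.2.le s)

/-- A sequentially interactive protocol for `n` players using the channel families
`𝒲_1, …, 𝒲_n` (players are indexed from `0`). The public randomness takes values in `U` and the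
private randomness of player `t` in `V t`, with laws `pubLaw` and `privLaw t`. Player `t` selects
the channel `select t u v` from the public randomness `u` and its own private randomness `v`. -/
structure SeqProtocol (X Y U : Type*) [MeasurableSpace X] [MeasurableSpace Y] [MeasurableSpace U]
    {n : ℕ} (V : Fin n → Type*) [∀ t, MeasurableSpace (V t)]
    (𝒲 : (t : Fin n) → Set (Channel X Y t)) where
  pubLaw : Measure U
  pubLaw_prob : IsProbabilityMeasure pubLaw
  privLaw : (t : Fin n) → Measure (V t)
  privLaw_prob : ∀ t, IsProbabilityMeasure (privLaw t)
  select : (t : Fin n) → U → V t → Channel X Y t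
  select_mem : ∀ t u v, select t u v ∈ 𝒲 t
  measurable_select : ∀ t : Fin n,
    Measurable fun q : U × V t × X × (Fin (t : ℕ) → Y) => (select t q.1 q.2.1).1 q.2.2

attribute [instance] SeqProtocol.pubLaw_prob SeqProtocol.privLaw_prob

theorem sum_prod_messagePrefix {Y : Type*} [Fintype Y] {n : ℕ}
    (w : (t : Fin n) → (Fin (t : ℕ) → Y) → Y → ℝ≥0∞) (hw : ∀ t h, ∑ y, w t h y = 1) :
    ∑ y : Fin n → Y, ∏ t, w t (messagePrefix y t) (y t) = 1 := by
  induction n with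
  | zero => simp
  | succ n ih =>
    rw [← (Fin.snocEquiv fun _ : Fin (n + 1) => Y).sum_comp, Fintype.sum_prod_type_right,
      ← ih (fun t => w t.castSucc) (fun t => hw t.castSucc)]
    refine Finset.sum_congr rfl fun y _ => ?_
    have key : ∀ c : Y, ∏ t, w t (messagePrefix (Fin.snoc (α := fun _ => Y) y c) t)
        (Fin.snoc (α := fun _ => Y) y c t) =
        (∏ t : Fin n, w t.castSucc (messagePrefix y t) (y t)) * w (Fin.last n) y c := by
      intro c
      rw [Fin.prod_univ_castSucc]
      congr 1
      · refine Finset.prod_congr rfl fun t _ => ?_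
        have hp : messagePrefix (Fin.snoc (α := fun _ => Y) y c) t.castSucc =
            messagePrefix y t :=
          funext fun s => Fin.snoc_castSucc (α := fun _ => Y) c y (Fin.castLE t.2.le s)
        exact congrArg₂ (w t.castSucc) hp <|
          Fin.snoc_castSucc (α := fun _ => Y) c y t
      · have hp : messagePrefix (Fin.snoc (α := fun _ => Y) y c) (Fin.last n) = y :=
          funext fun s => Fin.snoc_castSucc (α := fun _ => Y) c y s
        exact congrArg₂ (w (Fin.last n)) hp <| Fin.snoc_last (α := fun _ => Y) c y
    change ∑ c : Y, ∏ t, w t (messagePrefix (Fin.snoc (α := fun _ => Y) y c) t)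
        (Fin.snoc (α := fun _ => Y) y c t) = _
    simp_rw [key]
    rw [← Finset.mul_sum, hw, mul_one]

namespace SeqProtocol

variable {X Y U : Type*} [MeasurableSpace X] [MeasurableSpace Y] [MeasurableSpace U]
  {n : ℕ} {V : Fin n → Type*} [∀ t, MeasurableSpace (V t)]
  {𝒲 : (t : Fin n) → Set (Channel X Y t)}

/-- The probability that the messages are `y`, given public randomness `u`, private randomness `v`
and samples `x`: the product over `t` of `W_t(y_t ∣ x_t, y_1, …, y_{t-1})`. -/
def messageProb (P : SeqProtocol X Y U V 𝒲) (ω : U × ((t : Fin n) → V t) × (Fin n → X))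
    (y : Fin n → Y) : ℝ≥0∞ :=
  ∏ t : Fin n, (P.select t ω.1 (ω.2.1 t)).1 (ω.2.2 t, messagePrefix y t) {y t}

theorem measurable_messageProb [DiscreteMeasurableSpace Y] (P : SeqProtocol X Y U V 𝒲)
    (y : Fin n → Y) : Measurable fun ω => P.messageProb ω y := by
  unfold messageProb
  refine Finset.measurable_prod _ fun t _ => ?_
  have h1 := (Measure.measurable_coe (measurableSet_singleton (y t))).comp (P.measurable_select t)
  have h2 : Measurable fun ω : U × ((t : Fin n) → V t) × (Fin n → X) =>
      ((ω.1, ω.2.1 t, ω.2.2 t, messagePrefix y t) : U × V t × X × (Fin (t : ℕ) → Y)) := by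
    fun_prop
  exact h1.comp h2

/-- The conditional law of the messages `Y^n` given all randomness and all samples. -/
def messageKernel [Fintype Y] [DiscreteMeasurableSpace Y] (P : SeqProtocol X Y U V 𝒲) :
    Kernel (U × ((t : Fin n) → V t) × (Fin n → X)) (Fin n → Y) where
  toFun ω := ∑ y : Fin n → Y, P.messageProb ω y • Measure.dirac y
  measurable' := by
    refine Measure.measurable_of_measurable_coe _ fun s _ => ?_
    simp only [Measure.finsetSum_apply, Measure.smul_apply, smul_eq_mul]
    exact Finset.measurable_sum _ fun y _ => (P.measurable_messageProb y).mul_const _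

instance [Fintype Y] [DiscreteMeasurableSpace Y] (P : SeqProtocol X Y U V 𝒲) :
    IsMarkovKernel P.messageKernel := by
  refine ⟨fun ω => ⟨?_⟩⟩
  change (∑ y : Fin n → Y, P.messageProb ω y • Measure.dirac y) Set.univ = 1
  simp only [Measure.finsetSum_apply, Measure.smul_apply, smul_eq_mul, measure_univ, mul_one]
  refine sum_prod_messagePrefix
    (fun t h y => (P.select t ω.1 (ω.2.1 t)).1 (ω.2.2 t, h) {y}) fun t h => ?_
  have := (P.select t ω.1 (ω.2.1 t)).2
  rw [sum_measure_singleton, Finset.coe_univ, measure_univ]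

/-- The joint law of public randomness, private randomness, samples and messages when the samples
are i.i.d. with law `p`; the public randomness, the private randomness of the players and the
samples are mutually independent. -/
def jointLaw [Fintype Y] [DiscreteMeasurableSpace Y] (P : SeqProtocol X Y U V 𝒲) (p : Measure X)
    [IsProbabilityMeasure p] :
    Measure ((U × ((t : Fin n) → V t) × (Fin n → X)) × (Fin n → Y)) :=
  (P.pubLaw.prod ((Measure.pi P.privLaw).prod (Measure.pi fun _ : Fin n => p))) ⊗ₘ P.messageKernel

/-- The law of the transcript `(Y^n, U)` when the samples are i.i.d. with law `p`. -/
def transcriptLaw [Fintype Y] [DiscreteMeasurableSpace Y] (P : SeqProtocol X Y U V 𝒲)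
    (p : Measure X) [IsProbabilityMeasure p] : Measure ((Fin n → Y) × U) :=
  (P.jointLaw p).map fun q => (q.2, q.1.1)

/-- The law of the messages `Y^n` when the samples are i.i.d. with law `p`. -/
def messageLaw [Fintype Y] [DiscreteMeasurableSpace Y] (P : SeqProtocol X Y U V 𝒲)
    (p : Measure X) [IsProbabilityMeasure p] : Measure (Fin n → Y) :=
  (P.jointLaw p).map fun q => q.2

end SeqProtocol

end

/-!
Fix the public randomness. As samples and private randomness are independent across players, the
message law under `p_z` is a product of transition probabilities `E_{p_z}[W̄_t(y ∣ X, past)]`, where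
`W̄_t` is the channel of player `t` averaged over its private randomness
(`SeqProtocol.transcriptLaw_apply`).

Let `P` and `Q` be the message laws under `p_z` and `p_{z^{⊕i}}`. Total variation is compared with
the triangular discrimination through `d_TV(P, Q)² ≤ 2 (∑ P² / (P + Q) - 1 / 2)`. With `L` the
likelihood ratio `dQ / dP` of the past, `∑ P² / (P + Q)` is `E_P[1 / (1 + L)]`, and `L` is a
martingale under `P`. The second-order effect on `1 / (1 + L)` of multiplying `L` by a factor `r` is
at most `(r - 1)²`, whatever `L` is. Hence `d_TV(P, Q)²` is at most twice the sum over players of the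
one-step chi-squared divergence, averaged over a past with law `P` (`sum_sq_seqProb_div_add_le`,
`sq_half_sum_abs_seqProb_sub_le`). That the past is drawn from `P`, which does not depend on `i`, is
the point: for each past, the one-step divergences can be summed over `i`.

The sum over `i` of the one-step divergences is at most `α² ∑ y, ‖E[φ W̄_y]‖² / E[W̄_y]`. The inner sum
is at most `|Y|` by Bessel's inequality (`channelInfoBound_card`), and at most `2 σ² log |Y|` in the
subgaussian case (`channelInfoBound_of_subgaussian`): testing with `exp` in the direction of
`E[φ W̄_y]` gives `‖E[φ W̄_y]‖² ≤ 2 σ² w² log (1 / w)` with `w = E[W̄_y]`.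

Finally, matching `z` with `z^{⊕i}` writes the difference of the two conditional mixtures as an
average of differences over the law of `Z` given `Z_i = -1`. Since `τ ≤ 1 / 2`, this law is at most
twice that of `Z`, and convexity gives the bound with constants `4` and `8` in place of `7` and `14`
(`sq_avgDiscrepancy_le`, `SeqProtocol.sq_avgDiscrepancy_transcriptLaw_le`). The message laws are
marginals of the transcript laws.
-/

noncomputable section

/-! ### Total variation and triangular discrimination -/

/-- One step of the growth of `∑ P² / (P + Q)`, when the probabilities `A` and `B` of a past are
multiplied by transition probabilities `a` and `b`. With `x = B / A` and `r = b / a` it is the bound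
`1 / (1 + x r) ≤ 1 / (1 + x) - x (r - 1) / (1 + x)² + (r - 1)²`; the middle term on the right
vanishes when summed over the next message. The factor of `(b - a)² / a` does not involve `B`. -/
theorem sq_div_add_le_of_step {a b A B : ℝ} (ha : 0 ≤ a) (hb : 0 ≤ b) (hA : 0 ≤ A) (hB : 0 ≤ B)
    (hab : a = 0 → b = 0) :
    (A * a) ^ 2 / (A * a + B * b) ≤
      a * (A ^ 2 / (A + B)) - A ^ 2 * B / (A + B) ^ 2 * (b - a) + A * ((b - a) ^ 2 / a) := by
  rcases ha.eq_or_lt with rfl | ha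
  · simp [hab rfl]
  rcases hA.eq_or_lt with rfl | hA
  · simp
  have h1 : 0 < A + B := by positivity
  have h2 : 0 < A * a + B * b := by positivity
  have key : (A * a) ^ 2 / (A * a + B * b) =
      a * (A ^ 2 / (A + B)) - A ^ 2 * B / (A + B) ^ 2 * (b - a) +
        (A * a / (A * a + B * b)) * (B / (A + B)) ^ 2 * (A * ((b - a) ^ 2 / a)) := by
    field_simp
    ring
  rw [key]
  have h3 : A * a / (A * a + B * b) ≤ 1 :=
    div_le_one_of_le₀ (le_add_of_nonneg_right (by positivity)) h2.le
  have h4 : (B / (A + B)) ^ 2 ≤ 1 :=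
    pow_le_one₀ (by positivity) (div_le_one_of_le₀ (by linarith) h1.le)
  have h5 : (A * a / (A * a + B * b)) * (B / (A + B)) ^ 2 ≤ 1 :=
    mul_le_one₀ h3 (by positivity) h4
  have h6 : 0 ≤ A * ((b - a) ^ 2 / a) := by positivity
  linarith [mul_le_of_le_one_left h6 h5]

/-- Total variation is controlled by the triangular discrimination `∑ (P - Q)² / (P + Q)`, which
for probability vectors equals `4 ∑ P² / (P + Q) - 2`. -/
theorem sq_half_sum_abs_sub_le {ι : Type*} [Fintype ι] (P Q : ι → ℝ) (hP : ∀ i, 0 ≤ P i)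
    (hQ : ∀ i, 0 ≤ Q i) (hP1 : ∑ i, P i = 1) (hQ1 : ∑ i, Q i = 1) :
    (1 / 2 * ∑ i, |Q i - P i|) ^ 2 ≤ 2 * (∑ i, P i ^ 2 / (P i + Q i) - 1 / 2) := by
  have hpt : ∀ i, P i ^ 2 / (P i + Q i) =
      1 / 4 * ((Q i - P i) ^ 2 / (P i + Q i)) + (3 / 4 * P i - 1 / 4 * Q i) := by
    intro i
    rcases (add_nonneg (hP i) (hQ i)).eq_or_lt with h | h
    · have h1 : P i = 0 := by linarith [hP i, hQ i]
      have h2 : Q i = 0 := by linarith [hP i, hQ i]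
      simp [h1, h2]
    · field_simp
      ring
  have hcs : (∑ i, |Q i - P i|) ^ 2 ≤
      (∑ i, (Q i - P i) ^ 2 / (P i + Q i)) * ∑ i, (P i + Q i) := by
    refine Finset.sum_sq_le_sum_mul_sum_of_sq_le_mul _
      (fun i _ => div_nonneg (sq_nonneg _) (add_nonneg (hP i) (hQ i)))
      (fun i _ => add_nonneg (hP i) (hQ i)) fun i _ => ?_
    rcases (add_nonneg (hP i) (hQ i)).eq_or_lt with h | h
    · have h1 : P i = 0 := by linarith [hP i, hQ i]
      have h2 : Q i = 0 := by linarith [hP i, hQ i]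
      simp [h1, h2]
    · rw [sq_abs, div_mul_cancel₀ _ h.ne']
  rw [Finset.sum_add_distrib, hP1, hQ1] at hcs
  simp_rw [hpt]
  rw [Finset.sum_add_distrib, Finset.sum_sub_distrib, ← Finset.mul_sum, ← Finset.mul_sum,
    ← Finset.mul_sum, hP1, hQ1]
  linarith

theorem abs_sum_le_half_sum_abs {ι : Type*} [Fintype ι] (d : ι → ℝ) (hd : ∑ i, d i = 0)
    (s : Finset ι) : |∑ i ∈ s, d i| ≤ 1 / 2 * ∑ i, |d i| := by
  classical
  have h0 : ∑ i ∈ s, d i + ∑ i ∈ sᶜ, d i = 0 := by rw [Finset.sum_add_sum_compl, hd]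
  have h1 := Finset.sum_add_sum_compl s fun i => |d i|
  have h2 := Finset.abs_sum_le_sum_abs d s
  have h3 := Finset.abs_sum_le_sum_abs d sᶜ
  rw [show ∑ i ∈ sᶜ, d i = -∑ i ∈ s, d i by linarith, abs_neg] at h3
  linarith

/-! ### Divergence between sequences of messages -/

section Transcripts

variable {Y : Type*}

/-- The law of a sequence of `n` messages whose transition probabilities are `w t h y`. -/
def seqProb {n : ℕ} (w : (t : Fin n) → (Fin (t : ℕ) → Y) → Y → ℝ) (y : Fin n → Y) : ℝ :=
  ∏ t, w t (messagePrefix y t) (y t)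

theorem messagePrefix_snoc_castSucc {n : ℕ} (y : Fin n → Y) (c : Y) (t : Fin n) :
    messagePrefix (Fin.snoc (α := fun _ => Y) y c) t.castSucc = messagePrefix y t :=
  funext fun s => Fin.snoc_castSucc (α := fun _ => Y) c y (Fin.castLE t.2.le s)

theorem messagePrefix_snoc_last {n : ℕ} (y : Fin n → Y) (c : Y) :
    messagePrefix (Fin.snoc (α := fun _ => Y) y c) (Fin.last n) = y :=
  funext fun s => Fin.snoc_castSucc (α := fun _ => Y) c y s

theorem seqProb_snoc {n : ℕ} (w : (t : Fin (n + 1)) → (Fin (t : ℕ) → Y) → Y → ℝ)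
    (y : Fin n → Y) (c : Y) :
    seqProb w (Fin.snoc (α := fun _ => Y) y c) =
      seqProb (fun t => w t.castSucc) y * w (Fin.last n) y c := by
  unfold seqProb
  rw [Fin.prod_univ_castSucc]
  congr 1
  · refine Finset.prod_congr rfl fun t _ => ?_
    exact congrArg₂ (w t.castSucc) (messagePrefix_snoc_castSucc y c t) <|
      Fin.snoc_castSucc (α := fun _ => Y) c y t
  · exact congrArg₂ (w (Fin.last n)) (messagePrefix_snoc_last y c) <|
      Fin.snoc_last (α := fun _ => Y) c y

theorem sum_snoc [Fintype Y] {n : ℕ} (f : (Fin (n + 1) → Y) → ℝ) :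
    ∑ y, f y = ∑ y : Fin n → Y, ∑ c : Y, f (Fin.snoc (α := fun _ => Y) y c) := by
  rw [← (Fin.snocEquiv fun _ : Fin (n + 1) => Y).sum_comp, Fintype.sum_prod_type_right]
  rfl

theorem seqProb_nonneg {n : ℕ} {w : (t : Fin n) → (Fin (t : ℕ) → Y) → Y → ℝ}
    (hw : ∀ t h y, 0 ≤ w t h y) (y : Fin n → Y) : 0 ≤ seqProb w y :=
  Finset.prod_nonneg fun _ _ => hw _ _ _

variable [Fintype Y]

theorem sum_seqProb {n : ℕ} {w : (t : Fin n) → (Fin (t : ℕ) → Y) → Y → ℝ}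
    (hw : ∀ t h, ∑ y, w t h y = 1) : ∑ y, seqProb w y = 1 := by
  induction n with
  | zero => simp [seqProb]
  | succ n ih =>
    simp_rw [sum_snoc, seqProb_snoc, ← Finset.mul_sum, hw, mul_one]
    exact ih fun t => hw t.castSucc

/-- The chi-squared divergence `χ²(b ‖ a)` of two laws on a finite type, where `b` vanishes
wherever `a` does: points with `a y = 0` contribute `0`. -/
def chiSq (a b : Y → ℝ) : ℝ := ∑ y, (b y - a y) ^ 2 / a y

/-- Chain rule: `∑ P² / (P + Q)` exceeds its minimum `1 / 2` by at most the sum of the one-step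
chi-squared divergences, averaged over a past drawn from the first law `P` only. -/
theorem sum_sq_seqProb_div_add_le {n : ℕ} {a b : (t : Fin n) → (Fin (t : ℕ) → Y) → Y → ℝ}
    (ha : ∀ t h y, 0 ≤ a t h y) (hb : ∀ t h y, 0 ≤ b t h y)
    (ha1 : ∀ t h, ∑ y, a t h y = 1) (hb1 : ∀ t h, ∑ y, b t h y = 1)
    (hab : ∀ t h y, a t h y = 0 → b t h y = 0) :
    ∑ y, seqProb a y ^ 2 / (seqProb a y + seqProb b y) ≤
      1 / 2 + ∑ y, seqProb a y *
        ∑ t, chiSq (a t (messagePrefix y t)) (b t (messagePrefix y t)) := by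
  induction n with
  | zero => simp [seqProb]; norm_num
  | succ n ih =>
    have h := ih (a := fun t => a t.castSucc) (b := fun t => b t.castSucc)
      (fun t => ha t.castSucc) (fun t => hb t.castSucc) (fun t => ha1 t.castSucc)
      (fun t => hb1 t.castSucc) (fun t => hab t.castSucc)
    rw [sum_snoc, sum_snoc]
    simp_rw [seqProb_snoc, Fin.sum_univ_castSucc]
    set A := seqProb fun t : Fin n => a t.castSucc with hA
    set B := seqProb fun t : Fin n => b t.castSucc with hB
    have hA0 : ∀ y, 0 ≤ A y := seqProb_nonneg fun t => ha t.castSucc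
    have hB0 : ∀ y, 0 ≤ B y := seqProb_nonneg fun t => hb t.castSucc
    have hstep : ∀ y : Fin n → Y, ∑ c, (A y * a (Fin.last n) y c) ^ 2 /
        (A y * a (Fin.last n) y c + B y * b (Fin.last n) y c) ≤
        A y ^ 2 / (A y + B y) + A y * chiSq (a (Fin.last n) y) (b (Fin.last n) y) := by
      intro y
      refine (Finset.sum_le_sum fun c _ => sq_div_add_le_of_step (ha (Fin.last n) y c)
        (hb (Fin.last n) y c) (hA0 y) (hB0 y) (hab (Fin.last n) y c)).trans_eq ?_
      rw [Finset.sum_add_distrib, Finset.sum_sub_distrib, ← Finset.sum_mul, ← Finset.mul_sum,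
        ← Finset.mul_sum, Finset.sum_sub_distrib, ha1, hb1, chiSq]
      ring
    have hR : ∀ y : Fin n → Y, ∑ c, A y * a (Fin.last n) y c *
        (∑ t : Fin n, chiSq (a t.castSucc (messagePrefix
            (Fin.snoc (α := fun _ => Y) y c) t.castSucc))
          (b t.castSucc (messagePrefix (Fin.snoc (α := fun _ => Y) y c) t.castSucc)) +
        chiSq (a (Fin.last n) (messagePrefix (Fin.snoc (α := fun _ => Y) y c) (Fin.last n)))
          (b (Fin.last n) (messagePrefix (Fin.snoc (α := fun _ => Y) y c) (Fin.last n)))) =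
        A y * (∑ t : Fin n, chiSq (a t.castSucc (messagePrefix y t))
            (b t.castSucc (messagePrefix y t))) +
          A y * chiSq (a (Fin.last n) y) (b (Fin.last n) y) := by
      intro y
      have e : ∀ c : Y, messagePrefix (Fin.snoc (α := fun _ => Y) y c) (Fin.last n) = y :=
        messagePrefix_snoc_last y
      have e' := fun (c : Y) (t : Fin n) => messagePrefix_snoc_castSucc y c t
      simp only [Fin.val_castSucc, Fin.val_last] at e e'
      simp_rw [e', e]
      rw [← Finset.sum_mul, ← Finset.mul_sum, ha1]
      ring
    rw [Finset.sum_congr rfl fun y _ => hR y, Finset.sum_add_distrib]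
    refine (Finset.sum_le_sum fun y _ => hstep y).trans ?_
    rw [Finset.sum_add_distrib]
    linarith

theorem sq_half_sum_abs_seqProb_sub_le {n : ℕ} {a b : (t : Fin n) → (Fin (t : ℕ) → Y) → Y → ℝ}
    (ha : ∀ t h y, 0 ≤ a t h y) (hb : ∀ t h y, 0 ≤ b t h y)
    (ha1 : ∀ t h, ∑ y, a t h y = 1) (hb1 : ∀ t h, ∑ y, b t h y = 1)
    (hab : ∀ t h y, a t h y = 0 → b t h y = 0) :
    (1 / 2 * ∑ y, |seqProb b y - seqProb a y|) ^ 2 ≤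
      2 * ∑ y, seqProb a y *
        ∑ t, chiSq (a t (messagePrefix y t)) (b t (messagePrefix y t)) := by
  have h1 := sq_half_sum_abs_sub_le (seqProb a) (seqProb b) (seqProb_nonneg ha)
    (seqProb_nonneg hb) (sum_seqProb ha1) (sum_seqProb hb1)
  have h2 := sum_sq_seqProb_div_add_le ha hb ha1 hb1 hab
  linarith

end Transcripts

/-! ### Correlation of a bounded function with orthonormal functions -/

section Correlation

variable {X : Type*} [MeasurableSpace X] {k : ℕ}

theorem memLp_two_of_orthonormal {μ : Measure X} {φ : Fin k → X → ℝ}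
    (hm : ∀ i, Measurable (φ i))
    (ho : ∀ i j, ∫ x, φ i x * φ j x ∂μ = if i = j then 1 else 0) (i : Fin k) :
    MemLp (φ i) 2 μ := by
  rw [memLp_two_iff_integrable_sq (hm i).aestronglyMeasurable]
  by_contra h
  have h1 := ho i i
  simp_rw [← pow_two] at h1
  rw [integral_undef h] at h1
  simp at h1

/-- Bessel's inequality. -/
theorem sum_sq_integral_mul_le {μ : Measure X} [IsProbabilityMeasure μ] {φ : Fin k → X → ℝ}
    (hm : ∀ i, Measurable (φ i))
    (ho : ∀ i j, ∫ x, φ i x * φ j x ∂μ = if i = j then 1 else 0)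
    {f : X → ℝ} (hf : MemLp f 2 μ) :
    ∑ i, (∫ x, φ i x * f x ∂μ) ^ 2 ≤ ∫ x, f x ^ 2 ∂μ := by
  have hφ := memLp_two_of_orthonormal hm ho
  set c : Fin k → ℝ := fun i => ∫ x, φ i x * f x ∂μ with hc
  have hff : Integrable (fun x => f x ^ 2) μ := hf.integrable_sq
  have hφf : ∀ i, Integrable (fun x => φ i x * f x) μ := fun i => (hφ i).integrable_mul hf
  have hφφ : ∀ i j, Integrable (fun x => φ i x * φ j x) μ :=
    fun i j => (hφ i).integrable_mul (hφ j)
  have hexp : ∀ x, (f x - ∑ i, c i * φ i x) ^ 2 = f x ^ 2 - 2 * ∑ i, c i * (φ i x * f x) +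
      ∑ i, ∑ j, c i * c j * (φ i x * φ j x) := by
    intro x
    have h1 : (∑ i, c i * φ i x) * (∑ j, c j * φ j x) =
        ∑ i, ∑ j, c i * c j * (φ i x * φ j x) := by
      rw [Finset.sum_mul_sum]
      exact Finset.sum_congr rfl fun i _ => Finset.sum_congr rfl fun j _ => by ring
    have h2 : ∑ i, c i * (φ i x * f x) = (∑ i, c i * φ i x) * f x := by
      rw [Finset.sum_mul]
      exact Finset.sum_congr rfl fun i _ => by ring
    rw [← h1, h2]
    ring
  have h0 : 0 ≤ ∫ x, (f x - ∑ i, c i * φ i x) ^ 2 ∂μ := integral_nonneg fun x => sq_nonneg _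
  have i1 : Integrable (fun x => 2 * ∑ i, c i * (φ i x * f x)) μ :=
    (integrable_finsetSum _ fun i _ => (hφf i).const_mul _).const_mul _
  have i2 : Integrable (fun x => ∑ i, ∑ j, c i * c j * (φ i x * φ j x)) μ :=
    integrable_finsetSum _ fun i _ => integrable_finsetSum _ fun j _ => (hφφ i j).const_mul _
  simp_rw [hexp] at h0
  have i3 : Integrable (fun x => f x ^ 2 - 2 * ∑ i, c i * (φ i x * f x)) μ := hff.sub i1
  rw [integral_add i3 i2, integral_sub hff i1, integral_const_mul,
    integral_finsetSum _ fun i _ => (hφf i).const_mul _,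
    integral_finsetSum _ fun i _ => integrable_finsetSum _ fun j _ => (hφφ i j).const_mul _] at h0
  simp_rw [integral_finsetSum _ fun j _ => (hφφ _ j).const_mul _, integral_const_mul, ho] at h0
  simp only [mul_ite, mul_one, mul_zero, Finset.sum_ite_eq, Finset.mem_univ, if_true] at h0
  have e : ∑ i, c i * ∫ x, φ i x * f x ∂μ = ∑ i, c i ^ 2 :=
    Finset.sum_congr rfl fun i _ => by rw [pow_two]
  rw [e] at h0
  linarith

/-- The mean of a subgaussian variable under the law of density `f / E[f]` is controlled by
`log (1 / E[f])`. -/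
theorem IsSubgaussian.sq_integral_mul_le {μ : Measure X} [IsProbabilityMeasure μ] {S : X → ℝ}
    {c : ℝ≥0} (hS : IsSubgaussian μ S c) {f : X → ℝ} (hf : Measurable f) (hf0 : ∀ x, 0 ≤ f x)
    (hf1 : ∀ x, f x ≤ 1) (hpos : 0 < ∫ x, f x ∂μ) :
    (∫ x, S x * f x ∂μ) ^ 2 ≤ 2 * c * (∫ x, f x ∂μ) ^ 2 * -Real.log (∫ x, f x ∂μ) := by
  obtain ⟨hSi, -, hmgf⟩ := hS
  set w := ∫ x, f x ∂μ with hw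
  have hfb : ∀ᵐ x ∂μ, ‖f x‖ ≤ 1 := ae_of_all _ fun x => by
    rw [Real.norm_of_nonneg (hf0 x)]; exact hf1 x
  have hfi : Integrable f μ := Integrable.of_bound hf.aestronglyMeasurable 1 hfb
  have hSf : Integrable (fun x => S x * f x) μ := hSi.mul_bdd hf.aestronglyMeasurable hfb
  set m := (∫ x, S x * f x ∂μ) / w with hm
  have hmw : ∫ x, S x * f x ∂μ = m * w := by rw [hm, div_mul_cancel₀ _ hpos.ne']
  -- The tangent-line bound `exp (l S) ≥ exp (l m) (1 + l (S - m))`, integrated against `f`.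
  have hexp : ∀ l : ℝ, w * Real.exp (l * m) ≤ Real.exp (c * l ^ 2 / 2) := by
    intro l
    have hint := hmgf.integrable_exp_mul l
    have hle : ∫ x, Real.exp (l * m) * ((1 - l * m) * f x + l * (S x * f x)) ∂μ ≤
        ∫ x, Real.exp (l * S x) ∂μ := by
      refine integral_mono (((hfi.const_mul _).add (hSf.const_mul _)).const_mul _) hint
        fun x => ?_
      have h1 := Real.add_one_le_exp (l * S x - l * m)
      rw [Real.exp_sub, le_div_iff₀ (Real.exp_pos _)] at h1
      have h2 := mul_le_mul_of_nonneg_right h1 (hf0 x)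
      have h3 := mul_le_of_le_one_right (Real.exp_pos (l * S x)).le (hf1 x)
      dsimp only
      linarith
    rw [integral_const_mul, integral_add (hfi.const_mul _) (hSf.const_mul _),
      integral_const_mul, integral_const_mul, hmw, ← hw] at hle
    have := hle.trans (hmgf.mgf_le l)
    linarith
  have hquad : ∀ l : ℝ, 0 ≤ (c : ℝ) / 2 * (l * l) + (-m) * l + -Real.log w := by
    intro l
    have := Real.log_le_log (by positivity) (hexp l)
    rw [Real.log_exp, Real.log_mul hpos.ne' (Real.exp_pos _).ne', Real.log_exp] at this
    linarith
  -- The quadratic is nonnegative for all `l`, so its discriminant is nonpositive; `c = 0` needs no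
  -- separate treatment.
  have hd := discrim_le_zero hquad
  rw [discrim] at hd
  rw [hmw]
  have : m ^ 2 ≤ 2 * c * -Real.log w := by linarith
  have := mul_le_mul_of_nonneg_right this (sq_nonneg w)
  linarith

theorem sum_sq_integral_mul_le_of_subgaussian {μ : Measure X} [IsProbabilityMeasure μ]
    {φ : Fin k → X → ℝ} {c : ℝ≥0} (hφ : ∀ i, MemLp (φ i) 2 μ)
    (hS : ∀ v : EuclideanSpace ℝ (Fin k), ‖v‖ = 1 →
      IsSubgaussian μ (fun x => ∑ i, v i * φ i x) c)
    {f : X → ℝ} (hf : Measurable f) (hf0 : ∀ x, 0 ≤ f x)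
    (hf1 : ∀ x, f x ≤ 1) (hpos : 0 < ∫ x, f x ∂μ) :
    ∑ i, (∫ x, φ i x * f x ∂μ) ^ 2 ≤
      2 * c * (∫ x, f x ∂μ) ^ 2 * -Real.log (∫ x, f x ∂μ) := by
  have hfb : ∀ᵐ x ∂μ, ‖f x‖ ≤ 1 := ae_of_all _ fun x => by
    rw [Real.norm_of_nonneg (hf0 x)]; exact hf1 x
  have hw1 : ∫ x, f x ∂μ ≤ 1 := by
    have := integral_mono (Integrable.of_bound hf.aestronglyMeasurable 1 hfb)
      (integrable_const (1 : ℝ)) hf1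
    simpa using this
  have hint : ∀ i, Integrable (fun x => φ i x * f x) μ := fun i =>
    ((hφ i).integrable (by norm_num)).mul_bdd hf.aestronglyMeasurable hfb
  -- The vector of correlations; the subgaussian bound is used in its direction.
  set g : EuclideanSpace ℝ (Fin k) := WithLp.toLp 2 fun i => ∫ x, φ i x * f x ∂μ with hg
  have hgi : ∀ i, g i = ∫ x, φ i x * f x ∂μ := fun i => rfl
  have hnorm : ∑ i, (∫ x, φ i x * f x ∂μ) ^ 2 = ‖g‖ ^ 2 := by
    rw [EuclideanSpace.norm_sq_eq]
    simp [hgi]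
  rw [hnorm]
  by_cases h0 : g = 0
  · have := Real.log_nonpos hpos.le hw1
    rw [h0, norm_zero, zero_pow two_ne_zero]
    exact mul_nonneg (by positivity) (by linarith)
  have hg0 : ‖g‖ ≠ 0 := norm_ne_zero_iff.2 h0
  have h1 := (hS (‖g‖⁻¹ • g) (by rw [norm_smul, norm_inv, norm_norm, inv_mul_cancel₀ hg0])
    ).sq_integral_mul_le hf hf0 hf1 hpos
  have h2 : ∫ x, (∑ i, (‖g‖⁻¹ • g) i * φ i x) * f x ∂μ = ‖g‖ := by
    simp_rw [Finset.sum_mul, mul_assoc]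
    rw [integral_finsetSum _ fun i _ => (hint i).const_mul _]
    simp_rw [integral_const_mul, ← hgi, PiLp.smul_apply, smul_eq_mul, mul_assoc, ← pow_two]
    rw [← Finset.mul_sum]
    have : ∑ i, g i ^ 2 = ‖g‖ ^ 2 := by rw [EuclideanSpace.norm_sq_eq]; simp
    rw [this, pow_two, inv_mul_cancel_left₀ hg0]
  rwa [h2] at h1

theorem sum_negMulLog_le_log_card {Y : Type*} [Fintype Y] [Nonempty Y] (w : Y → ℝ)
    (hw : ∀ y, 0 ≤ w y) (hw1 : ∑ y, w y = 1) :
    ∑ y, Real.negMulLog (w y) ≤ Real.log (Fintype.card Y) := by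
  have hc : (0 : ℝ) < Fintype.card Y := by exact_mod_cast Fintype.card_pos
  -- `-w log w ≤ w log N + (1/N - w)`, from `log t ≤ t - 1` at `t = 1 / (N w)`.
  have h : ∀ y, Real.negMulLog (w y) ≤
      w y * Real.log (Fintype.card Y) + ((Fintype.card Y : ℝ)⁻¹ - w y) := by
    intro y
    rcases (hw y).eq_or_lt with h0 | h0
    · rw [← h0]; simp
    · have h1 := Real.log_le_sub_one_of_pos (x := ((Fintype.card Y : ℝ) * w y)⁻¹) (by positivity)
      rw [Real.log_inv, Real.log_mul hc.ne' h0.ne'] at h1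
      have h2 := mul_le_mul_of_nonneg_left h1 (hw y)
      have h3 : w y * (((Fintype.card Y : ℝ) * w y)⁻¹ - 1) = (Fintype.card Y : ℝ)⁻¹ - w y := by
        field_simp
      rw [h3] at h2
      rw [Real.negMulLog]
      linarith
  refine (Finset.sum_le_sum fun y _ => h y).trans_eq ?_
  rw [Finset.sum_add_distrib, Finset.sum_sub_distrib, ← Finset.sum_mul, hw1]
  simp [hc.ne']

end Correlation

/-! ### The transcript law of a protocol -/

theorem lintegral_pi_prod {ι : Type*} [Fintype ι] {E : ι → Type*} [∀ i, MeasurableSpace (E i)]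
    (μ : ∀ i, Measure (E i)) [∀ i, IsProbabilityMeasure (μ i)] {f : ∀ i, E i → ℝ≥0∞}
    (hf : ∀ i, Measurable (f i)) :
    ∫⁻ x, ∏ i, f i (x i) ∂Measure.pi μ = ∏ i, ∫⁻ x, f i x ∂μ i := by
  have h := lintegral_prod_eq_prod_lintegral_of_indepFun (μ := Measure.pi μ) Finset.univ
    (fun i (x : ∀ i, E i) => f i (x i))
    (iIndepFun_pi (X := f) fun i => (hf i).aemeasurable)
    (fun i => (hf i).comp (measurable_pi_apply i))
  rw [h]
  exact Finset.prod_congr rfl fun i _ =>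
    (measurePreserving_eval μ i).lintegral_comp (hf i)

namespace SeqProtocol

variable {X Y U : Type*} [MeasurableSpace X] [MeasurableSpace Y] [MeasurableSpace U]
  {n : ℕ} {V : Fin n → Type*} [∀ t, MeasurableSpace (V t)]
  {𝒲 : (t : Fin n) → Set (Channel X Y t)}

/-- The channel of player `t` averaged over its private randomness: the probability of the
message `y` on input `x`, given public randomness `u` and earlier messages `h`. -/
def avgChannel (P : SeqProtocol X Y U V 𝒲) (u : U) (t : Fin n) (h : Fin (t : ℕ) → Y) (y : Y)
    (x : X) : ℝ≥0∞ :=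
  ∫⁻ v, (P.select t u v).1 (x, h) {y} ∂P.privLaw t

/-- The probability that player `t` sends `y` after the messages `h`, given public randomness `u`,
when its sample has law `p`. -/
def stepProb (P : SeqProtocol X Y U V 𝒲) (p : Measure X) (u : U) (t : Fin n)
    (h : Fin (t : ℕ) → Y) (y : Y) : ℝ :=
  ∫ x, (P.avgChannel u t h y x).toReal ∂p

theorem avgChannel_le_one (P : SeqProtocol X Y U V 𝒲) (u : U) (t : Fin n)
    (h : Fin (t : ℕ) → Y) (y : Y) (x : X) :
    P.avgChannel u t h y x ≤ 1 := by
  have : ∀ v, (P.select t u v).1 (x, h) {y} ≤ 1 := fun v => by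
    have := (P.select t u v).2
    exact prob_le_one
  exact (lintegral_mono this).trans (by simp)

theorem avgChannel_ne_top (P : SeqProtocol X Y U V 𝒲) (u : U) (t : Fin n)
    (h : Fin (t : ℕ) → Y) (y : Y) (x : X) :
    P.avgChannel u t h y x ≠ ∞ :=
  ((P.avgChannel_le_one u t h y x).trans_lt ENNReal.one_lt_top).ne

theorem toReal_avgChannel_le_one (P : SeqProtocol X Y U V 𝒲) (u : U) (t : Fin n)
    (h : Fin (t : ℕ) → Y) (y : Y) (x : X) :
    (P.avgChannel u t h y x).toReal ≤ 1 :=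
  ENNReal.toReal_le_of_le_ofReal one_pos.le (by simpa using P.avgChannel_le_one u t h y x)

theorem stepProb_nonneg (P : SeqProtocol X Y U V 𝒲) (p : Measure X) (u : U) (t : Fin n)
    (h : Fin (t : ℕ) → Y) (y : Y) :
    0 ≤ P.stepProb p u t h y :=
  integral_nonneg fun _ => ENNReal.toReal_nonneg

/-- The total variation distance of the message laws for the sample laws `p` and `q`, given public
randomness `u`. -/
def condTV [Fintype Y] (P : SeqProtocol X Y U V 𝒲) (p q : Measure X) (u : U) : ℝ :=
  1 / 2 * ∑ y, |seqProb (P.stepProb q u) y - seqProb (P.stepProb p u) y|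

theorem condTV_nonneg [Fintype Y] (P : SeqProtocol X Y U V 𝒲) (p q : Measure X) (u : U) :
    0 ≤ P.condTV p q u :=
  mul_nonneg (by norm_num) (Finset.sum_nonneg fun _ _ => abs_nonneg _)

section

variable [DiscreteMeasurableSpace Y] (P : SeqProtocol X Y U V 𝒲)

theorem measurable_select_apply (t : Fin n) (h : Fin (t : ℕ) → Y) (y : Y) :
    Measurable fun q : (U × X) × V t => (P.select t q.1.1 q.2).1 (q.1.2, h) {y} := by
  have h1 := (Measure.measurable_coe (measurableSet_singleton y)).comp (P.measurable_select t)
  have h2 : Measurable fun q : (U × X) × V t =>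
      ((q.1.1, q.2, q.1.2, h) : U × V t × X × (Fin (t : ℕ) → Y)) := by
    fun_prop
  exact h1.comp h2

theorem measurable_uncurry_avgChannel (t : Fin n) (h : Fin (t : ℕ) → Y) (y : Y) :
    Measurable fun q : U × X => P.avgChannel q.1 t h y q.2 :=
  (P.measurable_select_apply t h y).lintegral_prod_right'

theorem measurable_avgChannel (u : U) (t : Fin n) (h : Fin (t : ℕ) → Y) (y : Y) :
    Measurable (P.avgChannel u t h y) :=
  (P.measurable_uncurry_avgChannel t h y).comp measurable_prodMk_left

theorem sum_avgChannel [Fintype Y] (u : U) (t : Fin n) (h : Fin (t : ℕ) → Y) (x : X) :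
    ∑ y, P.avgChannel u t h y x = 1 := by
  unfold avgChannel
  rw [← lintegral_finsetSum]
  · have : ∀ v, ∑ y, (P.select t u v).1 (x, h) {y} = 1 := fun v => by
      have := (P.select t u v).2
      rw [sum_measure_singleton, Finset.coe_univ, measure_univ]
    simp [this]
  · intro y _
    exact (P.measurable_select_apply t h y).comp (measurable_prodMk_left (x := (u, x)))

theorem sum_toReal_avgChannel [Fintype Y] (u : U) (t : Fin n) (h : Fin (t : ℕ) → Y) (x : X) :
    ∑ y, (P.avgChannel u t h y x).toReal = 1 := by
  rw [← ENNReal.toReal_sum fun y _ => P.avgChannel_ne_top u t h y x, sum_avgChannel,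
    ENNReal.toReal_one]

variable (p : Measure X) [IsProbabilityMeasure p]

theorem integrable_avgChannel (u : U) (t : Fin n) (h : Fin (t : ℕ) → Y) (y : Y) :
    Integrable (fun x => (P.avgChannel u t h y x).toReal) p :=
  Integrable.of_bound (P.measurable_avgChannel u t h y).ennreal_toReal.aestronglyMeasurable 1 <|
    ae_of_all _ fun x => by
      rw [Real.norm_of_nonneg ENNReal.toReal_nonneg]
      exact P.toReal_avgChannel_le_one u t h y x

theorem sum_stepProb [Fintype Y] (u : U) (t : Fin n) (h : Fin (t : ℕ) → Y) :
    ∑ y, P.stepProb p u t h y = 1 := by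
  unfold stepProb
  rw [← integral_finsetSum _ fun y _ => P.integrable_avgChannel p u t h y]
  simp [sum_toReal_avgChannel]

theorem ofReal_stepProb (u : U) (t : Fin n) (h : Fin (t : ℕ) → Y) (y : Y) :
    ENNReal.ofReal (P.stepProb p u t h y) = ∫⁻ x, P.avgChannel u t h y x ∂p := by
  rw [stepProb, ofReal_integral_eq_lintegral_ofReal (P.integrable_avgChannel p u t h y)
    (ae_of_all _ fun _ => ENNReal.toReal_nonneg)]
  exact lintegral_congr fun x => ENNReal.ofReal_toReal (P.avgChannel_ne_top u t h y x)

theorem measurable_stepProb (t : Fin n) (h : Fin (t : ℕ) → Y) (y : Y) :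
    Measurable fun u => P.stepProb p u t h y :=
  ((P.measurable_uncurry_avgChannel t h y).ennreal_toReal.stronglyMeasurable.integral_prod_right
    (ν := p)).measurable

theorem measurable_seqProb_stepProb (y : Fin n → Y) :
    Measurable fun u => seqProb (P.stepProb p u) y :=
  Finset.measurable_prod _ fun t _ => P.measurable_stepProb p t _ _

/-- Integrating out the private randomness and the samples, which are independent across players,
factorizes the message probabilities. -/
theorem lintegral_messageProb (u : U) (y : Fin n → Y) :
    ∫⁻ r, P.messageProb (u, r) y ∂((Measure.pi P.privLaw).prod (Measure.pi fun _ : Fin n => p)) =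
      ENNReal.ofReal (seqProb (P.stepProb p u) y) := by
  have hm : Measurable fun r : (∀ t, V t) × (Fin n → X) => P.messageProb (u, r) y :=
    (P.measurable_messageProb y).comp measurable_prodMk_left
  rw [lintegral_prod_symm _ hm.aemeasurable]
  have h1 : ∀ x : Fin n → X, ∫⁻ v, P.messageProb (u, v, x) y ∂Measure.pi P.privLaw =
      ∏ t, P.avgChannel u t (messagePrefix y t) (y t) (x t) := fun x =>
    lintegral_pi_prod P.privLaw
      (f := fun t v => (P.select t u v).1 (x t, messagePrefix y t) {y t}) fun t =>
        (P.measurable_select_apply t (messagePrefix y t) (y t)).comp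
          (measurable_prodMk_left (x := (u, x t)))
  simp_rw [h1]
  rw [lintegral_pi_prod (fun _ => p) fun t => P.measurable_avgChannel u t _ _, seqProb,
    ENNReal.ofReal_prod_of_nonneg fun t _ => P.stepProb_nonneg p u t _ _]
  exact Finset.prod_congr rfl fun t _ => (P.ofReal_stepProb p u t _ _).symm

variable [Fintype Y]

theorem seqProb_stepProb_le_one (u : U) (y : Fin n → Y) : seqProb (P.stepProb p u) y ≤ 1 := by
  rw [← sum_seqProb (P.sum_stepProb p u)]
  exact Finset.single_le_sum (fun y _ => seqProb_nonneg (P.stepProb_nonneg p u) y)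
    (Finset.mem_univ y)

theorem transcriptLaw_apply {A : Set ((Fin n → Y) × U)} (hA : MeasurableSet A) :
    P.transcriptLaw p A = ∫⁻ u, ∑ y, A.indicator 1 (y, u) *
      ENNReal.ofReal (seqProb (P.stepProb p u) y) ∂P.pubLaw := by
  have hmap : Measurable fun q : (U × (∀ t, V t) × (Fin n → X)) × (Fin n → Y) => (q.2, q.1.1) := by
    fun_prop
  have hind : ∀ y : Fin n → Y,
      Measurable fun u : U => A.indicator (1 : (Fin n → Y) × U → ℝ≥0∞) (y, u) :=
    fun y => (measurable_one.indicator hA).comp measurable_prodMk_left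
  have hmeas : Measurable fun ω : U × (∀ t, V t) × (Fin n → X) =>
      ∑ y, A.indicator (1 : (Fin n → Y) × U → ℝ≥0∞) (y, ω.1) * P.messageProb ω y :=
    Finset.measurable_sum _ fun y _ =>
      ((hind y).comp measurable_fst).mul (P.measurable_messageProb y)
  rw [transcriptLaw, Measure.map_apply hmap hA, jointLaw, Measure.compProd_apply (hmap hA)]
  have h1 : ∀ ω, P.messageKernel ω (Prod.mk ω ⁻¹'
      ((fun q : (U × (∀ t, V t) × (Fin n → X)) × (Fin n → Y) => (q.2, q.1.1)) ⁻¹' A)) =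
      ∑ y, A.indicator (1 : (Fin n → Y) × U → ℝ≥0∞) (y, ω.1) * P.messageProb ω y := by
    intro ω
    change (∑ y : Fin n → Y, P.messageProb ω y • Measure.dirac y) _ = _
    simp only [Measure.finsetSum_apply, Measure.smul_apply, smul_eq_mul]
    refine Finset.sum_congr rfl fun y _ => ?_
    rw [Measure.dirac_apply, mul_comm]
    rfl
  simp_rw [h1]
  rw [lintegral_prod _ hmeas.aemeasurable]
  refine lintegral_congr fun u => ?_
  have hm : ∀ y, Measurable fun r : (∀ t, V t) × (Fin n → X) => P.messageProb (u, r) y :=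
    fun y => (P.measurable_messageProb y).comp measurable_prodMk_left
  dsimp only
  rw [lintegral_finsetSum _ fun y _ => (hm y).const_mul _]
  refine Finset.sum_congr rfl fun y _ => ?_
  rw [lintegral_const_mul _ (hm y), lintegral_messageProb]

theorem transcriptLaw_real_apply {A : Set ((Fin n → Y) × U)} (hA : MeasurableSet A) :
    (P.transcriptLaw p).real A = ∫ u, ∑ y, A.indicator 1 (y, u) *
      seqProb (P.stepProb p u) y ∂P.pubLaw := by
  have hm : Measurable fun u : U => ∑ y, A.indicator (1 : (Fin n → Y) × U → ℝ) (y, u) *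
      seqProb (P.stepProb p u) y :=
    Finset.measurable_sum _ fun y _ =>
      ((measurable_one.indicator hA).comp measurable_prodMk_left).mul
        (P.measurable_seqProb_stepProb p y)
  have h0 : ∀ (u : U) (y : Fin n → Y), 0 ≤ A.indicator (1 : (Fin n → Y) × U → ℝ) (y, u) *
      seqProb (P.stepProb p u) y := fun u y =>
    mul_nonneg (Set.indicator_nonneg (fun _ _ => zero_le_one) _)
      (seqProb_nonneg (P.stepProb_nonneg p u) y)
  rw [integral_eq_lintegral_of_nonneg_ae (ae_of_all _ fun u => Finset.sum_nonneg fun y _ => h0 u y)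
    hm.aestronglyMeasurable, Measure.real, P.transcriptLaw_apply p hA]
  congr 1
  refine lintegral_congr fun u => ?_
  rw [ENNReal.ofReal_sum_of_nonneg fun y _ => h0 u y]
  refine Finset.sum_congr rfl fun y _ => ?_
  by_cases h : (y, u) ∈ A <;> simp [h]

variable (q : Measure X) [IsProbabilityMeasure q]

theorem measurable_condTV : Measurable (P.condTV p q) :=
  (Finset.measurable_sum _ fun y _ => ((P.measurable_seqProb_stepProb q y).sub
    (P.measurable_seqProb_stepProb p y)).abs).const_mul _

theorem condTV_le_one (u : U) : P.condTV p q u ≤ 1 := by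
  have h : ∑ y, |seqProb (P.stepProb q u) y - seqProb (P.stepProb p u) y| ≤
      ∑ y, (seqProb (P.stepProb q u) y + seqProb (P.stepProb p u) y) := by
    refine Finset.sum_le_sum fun y _ => (abs_sub _ _).trans_eq ?_
    rw [abs_of_nonneg (seqProb_nonneg (P.stepProb_nonneg q u) y),
      abs_of_nonneg (seqProb_nonneg (P.stepProb_nonneg p u) y)]
  rw [Finset.sum_add_distrib, sum_seqProb (P.sum_stepProb q u),
    sum_seqProb (P.sum_stepProb p u)] at h
  rw [condTV]
  linarith

theorem memLp_condTV : MemLp (P.condTV p q) 2 P.pubLaw :=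
  MemLp.of_bound (P.measurable_condTV p q).aestronglyMeasurable 1 <| ae_of_all _ fun u => by
    rw [Real.norm_of_nonneg (P.condTV_nonneg p q u)]
    exact P.condTV_le_one p q u

theorem abs_transcriptLaw_real_sub_le {A : Set ((Fin n → Y) × U)} (hA : MeasurableSet A) :
    |(P.transcriptLaw q).real A - (P.transcriptLaw p).real A| ≤
      ∫ u, P.condTV p q u ∂P.pubLaw := by
  have hint : ∀ (r : Measure X) [IsProbabilityMeasure r], Integrable (fun u : U =>
      ∑ y, A.indicator (1 : (Fin n → Y) × U → ℝ) (y, u) * seqProb (P.stepProb r u) y) P.pubLaw := by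
    intro r _
    refine integrable_finsetSum _ fun y _ => Integrable.of_bound
      (((measurable_one.indicator hA).comp measurable_prodMk_left).mul
        (P.measurable_seqProb_stepProb r y)).aestronglyMeasurable 1 (ae_of_all _ fun u => ?_)
    have h0 := seqProb_nonneg (P.stepProb_nonneg r u) y
    by_cases h : (y, u) ∈ A
    · simpa [h, abs_of_nonneg h0] using P.seqProb_stepProb_le_one r u y
    · simp [h]
  rw [P.transcriptLaw_real_apply q hA, P.transcriptLaw_real_apply p hA,
    ← integral_sub (hint q) (hint p)]
  refine (abs_integral_le_integral_abs).trans (integral_mono ((hint q).sub (hint p)).abs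
    ((P.memLp_condTV p q).integrable (by norm_num)) fun u => ?_)
  classical
  have h := abs_sum_le_half_sum_abs
    (fun y => seqProb (P.stepProb q u) y - seqProb (P.stepProb p u) y)
    (by rw [Finset.sum_sub_distrib, sum_seqProb (P.sum_stepProb q u),
      sum_seqProb (P.sum_stepProb p u), sub_self])
    (Finset.univ.filter fun y => (y, u) ∈ A)
  rw [Finset.sum_filter] at h
  refine le_trans (le_of_eq ?_) h
  dsimp only
  rw [← Finset.sum_sub_distrib]
  congr 1
  refine Finset.sum_congr rfl fun y _ => ?_
  by_cases h : (y, u) ∈ A <;> simp [h]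

end

end SeqProtocol

/-! ### Conditional mixtures over the cube -/

section TotalVariation

variable {Ω Ω' : Type*} [MeasurableSpace Ω] [MeasurableSpace Ω']

theorem tvDist_nonneg (μ ν : Measure Ω) : 0 ≤ tvDist μ ν :=
  Real.iSup_nonneg fun _ => abs_nonneg _

theorem tvDist_le {μ ν : Measure Ω} {c : ℝ}
    (h : ∀ A, MeasurableSet A → |μ.real A - ν.real A| ≤ c) : tvDist μ ν ≤ c :=
  haveI : Nonempty {A : Set Ω // MeasurableSet A} := ⟨⟨∅, MeasurableSet.empty⟩⟩
  ciSup_le fun A => h A.1 A.2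

theorem abs_real_sub_le_tvDist (μ ν : Measure Ω) [IsFiniteMeasure μ] [IsFiniteMeasure ν]
    {A : Set Ω} (hA : MeasurableSet A) : |μ.real A - ν.real A| ≤ tvDist μ ν := by
  refine le_ciSup (f := fun A : {A : Set Ω // MeasurableSet A} => |μ.real A.1 - ν.real A.1|)
    ⟨μ.real Set.univ + ν.real Set.univ, ?_⟩ ⟨A, hA⟩
  rintro _ ⟨B, rfl⟩
  have h1 : μ.real B.1 ≤ μ.real Set.univ := measureReal_mono (Set.subset_univ _)
  have h2 : ν.real B.1 ≤ ν.real Set.univ := measureReal_mono (Set.subset_univ _)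
  have h3 : 0 ≤ μ.real B.1 := measureReal_nonneg
  have h4 : 0 ≤ ν.real B.1 := measureReal_nonneg
  exact abs_le.2 ⟨by linarith, by linarith⟩

theorem tvDist_map_le (μ ν : Measure Ω) [IsFiniteMeasure μ] [IsFiniteMeasure ν] {f : Ω → Ω'}
    (hf : Measurable f) : tvDist (μ.map f) (ν.map f) ≤ tvDist μ ν :=
  tvDist_le fun A hA => by
    rw [map_measureReal_apply hf hA, map_measureReal_apply hf hA]
    exact abs_real_sub_le_tvDist μ ν (hf hA)

end TotalVariation

section Mixture

variable {k : ℕ}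

/-- The mass that `rademacher τ` gives to the sign `s`. -/
def signMass (τ : ℝ) (s : ℤˣ) : ℝ := if s = 1 then τ else 1 - τ

theorem signMass_nonneg {τ : ℝ} (hτ : 0 ≤ τ) (hτ1 : τ ≤ 1) (s : ℤˣ) : 0 ≤ signMass τ s := by
  unfold signMass
  split_ifs <;> linarith

theorem rademacher_singleton (τ : ℝ) (s : ℤˣ) :
    rademacher τ {s} = ENNReal.ofReal (signMass τ s) := by
  rcases Int.units_eq_one_or s with rfl | rfl <;>
    simp [rademacher, signMass]

theorem isProbabilityMeasure_rademacher {τ : ℝ} (hτ : 0 ≤ τ) (hτ1 : τ ≤ 1) :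
    IsProbabilityMeasure (rademacher τ) := by
  constructor
  simp only [rademacher, Measure.add_apply, Measure.smul_apply, measure_univ, smul_eq_mul, mul_one]
  rw [← ENNReal.ofReal_add hτ (by linarith)]
  simp

theorem rademacherPow_singleton {τ : ℝ} (hτ : 0 ≤ τ) (hτ1 : τ ≤ 1) (z : Cube k) :
    (rademacherPow k τ) {z} = ENNReal.ofReal (∏ j, signMass τ (z j)) := by
  rw [rademacherPow, Measure.pi_singleton,
    ENNReal.ofReal_prod_of_nonneg fun j _ => signMass_nonneg hτ hτ1 _]
  simp_rw [rademacher_singleton]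

theorem rademacherPow_eval {τ : ℝ} (hτ : 0 ≤ τ) (hτ1 : τ ≤ 1) (i : Fin k) (s : ℤˣ) :
    (rademacherPow k τ) {z | z i = s} = ENNReal.ofReal (signMass τ s) := by
  have := isProbabilityMeasure_rademacher hτ hτ1
  rw [← rademacher_singleton]
  exact (measurePreserving_eval (fun _ : Fin k => rademacher τ) i).measure_preimage
    (measurableSet_singleton s).nullMeasurableSet

/-- The conditional probability of `Z = z` given `Z_i = s`. -/
def condWeight (τ : ℝ) (i : Fin k) (s : ℤˣ) (z : Cube k) : ℝ :=
  ((rademacherPow k τ)[|{z' : Cube k | z' i = s}]).real {z}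

theorem condWeight_eq {τ : ℝ} (hτ : 0 < τ) (hτ1 : τ < 1) (i : Fin k) (s : ℤˣ) (z : Cube k) :
    condWeight τ i s z = if z i = s then ∏ j ∈ Finset.univ.erase i, signMass τ (z j) else 0 := by
  have hs : 0 < signMass τ s := by
    unfold signMass
    split_ifs <;> linarith
  have hms : MeasurableSet {z' : Cube k | z' i = s} :=
    (measurableSet_singleton s).preimage (measurable_pi_apply i)
  rw [condWeight, Measure.real, cond_apply hms, rademacherPow_eval hτ.le hτ1.le]
  split_ifs with h
  · have hz : {z' : Cube k | z' i = s} ∩ {z} = {z} :=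
      Set.inter_eq_right.2 (Set.singleton_subset_iff.2 h)
    rw [hz, rademacherPow_singleton hτ.le hτ1.le, ENNReal.toReal_mul, ENNReal.toReal_inv,
      ENNReal.toReal_ofReal hs.le,
      ENNReal.toReal_ofReal (Finset.prod_nonneg fun j _ => signMass_nonneg hτ.le hτ1.le _),
      ← Finset.mul_prod_erase _ _ (Finset.mem_univ i), h, inv_mul_cancel_left₀ hs.ne']
  · have hz : {z' : Cube k | z' i = s} ∩ {z} = ∅ :=
      Set.inter_singleton_eq_empty.2 h
    simp [hz]

theorem sum_condWeight {τ : ℝ} (hτ : 0 < τ) (hτ1 : τ < 1) (i : Fin k) (s : ℤˣ) :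
    ∑ z, condWeight τ i s z = 1 := by
  have := isProbabilityMeasure_rademacher hτ.le hτ1.le
  have : IsProbabilityMeasure (rademacherPow k τ) := by
    unfold rademacherPow
    infer_instance
  have hs : 0 < signMass τ s := by
    unfold signMass
    split_ifs <;> linarith
  have hc : IsProbabilityMeasure ((rademacherPow k τ)[|{z' : Cube k | z' i = s}]) :=
    cond_isProbabilityMeasure (by
      rw [rademacherPow_eval hτ.le hτ1.le]
      simpa using hs)
  simp only [condWeight]
  rw [sum_measureReal_singleton]
  simp

theorem sum_prod_signMass {τ : ℝ} (hτ : 0 ≤ τ) (hτ1 : τ ≤ 1) :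
    ∑ z : Cube k, ∏ j, signMass τ (z j) = 1 := by
  have := isProbabilityMeasure_rademacher hτ hτ1
  have : IsProbabilityMeasure (rademacherPow k τ) := by
    unfold rademacherPow
    infer_instance
  have h : ∑ z : Cube k, (rademacherPow k τ).real {z} = 1 := by
    rw [sum_measureReal_singleton]
    simp
  rw [← h]
  refine Finset.sum_congr rfl fun z _ => ?_
  rw [Measure.real, rademacherPow_singleton hτ hτ1,
    ENNReal.toReal_ofReal (Finset.prod_nonneg fun j _ => signMass_nonneg hτ hτ1 _)]

theorem flipSign_flipSign (z : Cube k) (i : Fin k) : flipSign (flipSign z i) i = z := by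
  simp [flipSign]

theorem condWeight_flipSign {τ : ℝ} (hτ : 0 < τ) (hτ1 : τ < 1) (i : Fin k) (z : Cube k) :
    condWeight τ i 1 (flipSign z i) = condWeight τ i (-1) z := by
  rw [condWeight_eq hτ hτ1, condWeight_eq hτ hτ1]
  have h1 : flipSign z i i = 1 ↔ z i = -1 := by
    simp [flipSign, neg_eq_iff_eq_neg]
  simp only [h1]
  congr 1
  refine Finset.prod_congr rfl fun j hj => ?_
  rw [flipSign, Function.update_of_ne (Finset.ne_of_mem_erase hj)]

/-- As `τ ≤ 1 / 2`, conditioning on `Z_i = -1` at most doubles the probabilities. -/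
theorem condWeight_neg_one_le {τ : ℝ} (hτ : 0 < τ) (hτ' : τ ≤ 1 / 2) (i : Fin k) (z : Cube k) :
    condWeight τ i (-1) z ≤ 2 * ∏ j, signMass τ (z j) := by
  have h0 : 0 ≤ ∏ j ∈ Finset.univ.erase i, signMass τ (z j) :=
    Finset.prod_nonneg fun j _ => signMass_nonneg hτ.le (by linarith) _
  rw [condWeight_eq hτ (by linarith), ← Finset.mul_prod_erase _ _ (Finset.mem_univ i)]
  split_ifs with h
  · have : signMass τ (z i) = 1 - τ := by rw [h]; simp [signMass]
    rw [this]
    nlinarith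
  · have := signMass_nonneg hτ.le (by linarith) (z i)
    positivity

theorem condMixture_real_apply {Ω : Type*} [MeasurableSpace Ω] (τ : ℝ) (Q : Cube k → Measure Ω)
    [∀ z, IsFiniteMeasure (Q z)] (i : Fin k) (s : ℤˣ) (A : Set Ω) :
    (condMixture τ Q i s).real A = ∑ z, condWeight τ i s z * (Q z).real A := by
  rw [condMixture, Measure.real, Measure.finsetSum_apply, ENNReal.toReal_sum]
  · simp [condWeight, Measure.real]
  · intro z _
    exact ENNReal.mul_ne_top (measure_ne_top _ _) (measure_ne_top _ _)

theorem isFiniteMeasure_condMixture {Ω : Type*} [MeasurableSpace Ω] (τ : ℝ)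
    (Q : Cube k → Measure Ω) [∀ z, IsFiniteMeasure (Q z)] (i : Fin k) (s : ℤˣ) :
    IsFiniteMeasure (condMixture τ Q i s) := by
  constructor
  rw [condMixture, Measure.finsetSum_apply]
  exact ENNReal.sum_lt_top.2 fun z _ =>
    ENNReal.mul_lt_top (measure_lt_top _ _) (measure_lt_top _ _)

theorem avgDiscrepancy_nonneg {Ω : Type*} [MeasurableSpace Ω] (τ : ℝ) (Q : Cube k → Measure Ω) :
    0 ≤ avgDiscrepancy τ Q :=
  mul_nonneg (by positivity) (Finset.sum_nonneg fun _ _ => tvDist_nonneg _ _)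

theorem avgDiscrepancy_map_le {Ω Ω' : Type*} [MeasurableSpace Ω] [MeasurableSpace Ω'] (τ : ℝ)
    (Q : Cube k → Measure Ω) [∀ z, IsFiniteMeasure (Q z)] {f : Ω → Ω'} (hf : Measurable f) :
    avgDiscrepancy τ (fun z => (Q z).map f) ≤ avgDiscrepancy τ Q := by
  have h : ∀ i s, condMixture τ (fun z => (Q z).map f) i s = (condMixture τ Q i s).map f := by
    intro i s
    ext A hA
    rw [Measure.map_apply hf hA]
    simp [condMixture, Measure.map_apply hf hA]
  refine mul_le_mul_of_nonneg_left (Finset.sum_le_sum fun i _ => ?_) (by positivity)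
  have := isFiniteMeasure_condMixture τ Q i
  rw [h, h]
  exact tvDist_map_le _ _ hf

/-- The two conditional mixtures are compared by matching `z` with `z^{⊕i}`, both of which have the
same conditional weight. -/
theorem tvDist_condMixture_le {Ω : Type*} [MeasurableSpace Ω] {τ : ℝ} (hτ : 0 < τ) (hτ1 : τ < 1)
    (Q : Cube k → Measure Ω) [∀ z, IsFiniteMeasure (Q z)] (i : Fin k) {d : Cube k → ℝ}
    (hd : ∀ z A, MeasurableSet A → |(Q (flipSign z i)).real A - (Q z).real A| ≤ d z) :
    tvDist (condMixture τ Q i 1) (condMixture τ Q i (-1)) ≤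
      ∑ z, condWeight τ i (-1) z * d z := by
  refine tvDist_le fun A hA => ?_
  have hflip : Function.Involutive fun z : Cube k => flipSign z i := fun z => flipSign_flipSign z i
  rw [condMixture_real_apply, condMixture_real_apply, ← Equiv.sum_comp hflip.toPerm]
  simp only [Function.Involutive.coe_toPerm, condWeight_flipSign hτ hτ1]
  rw [← Finset.sum_sub_distrib]
  refine (Finset.abs_sum_le_sum_abs _ _).trans (Finset.sum_le_sum fun z _ => ?_)
  have h0 : 0 ≤ condWeight τ i (-1) z := measureReal_nonneg
  rw [← mul_sub, abs_mul, abs_of_nonneg h0]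
  exact mul_le_mul_of_nonneg_left (hd z A hA) h0

theorem sq_tvDist_condMixture_le {Ω : Type*} [MeasurableSpace Ω] {τ : ℝ} (hτ : 0 < τ)
    (hτ' : τ ≤ 1 / 2) (Q : Cube k → Measure Ω) [∀ z, IsFiniteMeasure (Q z)] (i : Fin k)
    {d : Cube k → ℝ}
    (hd : ∀ z A, MeasurableSet A → |(Q (flipSign z i)).real A - (Q z).real A| ≤ d z) :
    tvDist (condMixture τ Q i 1) (condMixture τ Q i (-1)) ^ 2 ≤
      2 * ∑ z, (∏ j, signMass τ (z j)) * d z ^ 2 := by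
  have hw : ∀ z, 0 ≤ condWeight τ i (-1) z := fun z => measureReal_nonneg
  have h1 := tvDist_condMixture_le hτ (by linarith) Q i hd
  have h2 : (∑ z, condWeight τ i (-1) z * d z) ^ 2 ≤
      (∑ z, condWeight τ i (-1) z) * ∑ z, condWeight τ i (-1) z * d z ^ 2 :=
    Finset.sum_sq_le_sum_mul_sum_of_sq_le_mul _ (fun z _ => hw z)
      (fun z _ => mul_nonneg (hw z) (sq_nonneg _)) fun z _ => le_of_eq (by ring)
  rw [sum_condWeight hτ (by linarith), one_mul] at h2
  refine (pow_le_pow_left₀ (tvDist_nonneg _ _) h1 2).trans (h2.trans ?_)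
  rw [Finset.mul_sum]
  refine Finset.sum_le_sum fun z _ => ?_
  rw [← mul_assoc]
  exact mul_le_mul_of_nonneg_right (condWeight_neg_one_le hτ hτ' i z) (sq_nonneg _)

theorem sq_avgDiscrepancy_le {Ω : Type*} [MeasurableSpace Ω] {τ : ℝ} (hτ : 0 < τ)
    (hτ' : τ ≤ 1 / 2) (Q : Cube k → Measure Ω) [∀ z, IsFiniteMeasure (Q z)]
    {d : Cube k → Fin k → ℝ} {D : ℝ}
    (hd : ∀ z i A, MeasurableSet A → |(Q (flipSign z i)).real A - (Q z).real A| ≤ d z i)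
    (hD : ∀ z, ∑ i, d z i ^ 2 ≤ D) :
    avgDiscrepancy τ Q ^ 2 ≤ 2 / k * D := by
  rcases Nat.eq_zero_or_pos k with rfl | hk
  · simp [avgDiscrepancy]
  have hk0 : (0 : ℝ) < k := by exact_mod_cast hk
  set T : Fin k → ℝ := fun i => tvDist (condMixture τ Q i 1) (condMixture τ Q i (-1)) with hT
  have h1 : (∑ i, T i) ^ 2 ≤ k * ∑ i, T i ^ 2 := by
    simpa using sq_sum_le_card_mul_sum_sq (s := Finset.univ) (f := T)
  have h2 : ∑ i, T i ^ 2 ≤ 2 * D := by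
    calc ∑ i, T i ^ 2 ≤ ∑ i, 2 * ∑ z, (∏ j, signMass τ (z j)) * d z i ^ 2 :=
          Finset.sum_le_sum fun i _ => sq_tvDist_condMixture_le hτ hτ' Q i fun z => hd z i
      _ = 2 * ∑ z, (∏ j, signMass τ (z j)) * ∑ i, d z i ^ 2 := by
          rw [← Finset.mul_sum, Finset.sum_comm]
          simp_rw [Finset.mul_sum]
      _ ≤ 2 * ∑ z : Cube k, (∏ j, signMass τ (z j)) * D := by
          refine mul_le_mul_of_nonneg_left (Finset.sum_le_sum fun z _ => ?_) zero_le_two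
          exact mul_le_mul_of_nonneg_left (hD z)
            (Finset.prod_nonneg fun j _ => signMass_nonneg hτ.le (by linarith) _)
      _ = 2 * D := by rw [← Finset.sum_mul, sum_prod_signMass hτ.le (by linarith), one_mul]
  calc avgDiscrepancy τ Q ^ 2 = (1 / k) ^ 2 * (∑ i, T i) ^ 2 := by
        rw [avgDiscrepancy, mul_pow]
    _ ≤ (1 / k) ^ 2 * (k * (2 * D)) := by gcongr; exact h1.trans (by gcongr)
    _ = 2 / k * D := by field_simp

end Mixture

/-! ### Information about the perturbations carried by a channel -/

section Perturbation

variable {X : Type*} [MeasurableSpace X] {k : ℕ} {p : Cube k → Measure X}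
  [∀ z, IsProbabilityMeasure (p z)] {α : ℝ} {φ : Cube k → Fin k → X → ℝ}

theorem DensitiesExist.exists_integral_flipSign_eq (hdens : DensitiesExist p α φ)
    (horth : OrthonormalPerturbations p φ) (z : Cube k) (i : Fin k) :
    ∃ a : ℝ, |a| ≤ α ∧ ∀ f : X → ℝ, MemLp f 2 (p z) →
      ∫ x, f x ∂p (flipSign z i) = ∫ x, f x ∂p z + a * ∫ x, φ z i x * f x ∂p z := by
  obtain ⟨hac, -, a, ha, hae⟩ := hdens z i
  refine ⟨a, ha, fun f hf => ?_⟩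
  have hφ := memLp_two_of_orthonormal (fun j => (hdens z j).2.1) (horth z) i
  have hφf : Integrable (fun x => φ z i x * f x) (p z) := hφ.integrable_mul hf
  rw [← integral_rnDeriv_smul hac, ← integral_const_mul,
    ← integral_add (hf.integrable (by norm_num)) (hφf.const_mul a)]
  refine integral_congr_ae ?_
  filter_upwards [hae] with x hx
  rw [hx, smul_eq_mul]
  ring

theorem memLp_two_of_mem_Icc {μ : Measure X} [IsProbabilityMeasure μ] {f : X → ℝ}
    (hf : Measurable f) (hf0 : ∀ x, 0 ≤ f x) (hf1 : ∀ x, f x ≤ 1) : MemLp f 2 μ :=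
  MemLp.of_bound hf.aestronglyMeasurable 1 <| ae_of_all _ fun x => by
    rw [Real.norm_of_nonneg (hf0 x)]
    exact hf1 x

/-- An upper bound `C` on the information that a channel `x ↦ (f y x)_y` with output alphabet `Y`
gives about the perturbation functions, `∑ y, ‖E[φ f_y]‖² / E[f_y] ≤ C`. Messages of probability
`0` contribute `0`. -/
def ChannelInfoBound (Y : Type*) [Fintype Y] (p : Cube k → Measure X)
    (φ : Cube k → Fin k → X → ℝ) (C : ℝ) : Prop :=
  ∀ (z : Cube k) (f : Y → X → ℝ), (∀ y, Measurable (f y)) → (∀ y x, 0 ≤ f y x) →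
    (∀ y x, f y x ≤ 1) → (∀ x, ∑ y, f y x = 1) →
    ∑ y, (∑ i, (∫ x, φ z i x * f y x ∂p z) ^ 2) / ∫ x, f y x ∂p z ≤ C

variable {Y : Type*} [Fintype Y]

/-- By Bessel's inequality `‖E[φ f_y]‖² ≤ E[f_y²] ≤ E[f_y]`, so every message contributes at
most `1`. -/
theorem channelInfoBound_card (hdens : DensitiesExist p α φ)
    (horth : OrthonormalPerturbations p φ) : ChannelInfoBound Y p φ (Fintype.card Y) := by
  intro z f hf hf0 hf1 _
  have h : ∀ y, (∑ i, (∫ x, φ z i x * f y x ∂p z) ^ 2) / ∫ x, f y x ∂p z ≤ 1 := by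
    intro y
    have hL := memLp_two_of_mem_Icc (μ := p z) (hf y) (hf0 y) (hf1 y)
    refine div_le_one_of_le₀ ?_ (integral_nonneg (hf0 y))
    refine (sum_sq_integral_mul_le (fun i => (hdens z i).2.1) (horth z) hL).trans
      (integral_mono hL.integrable_sq (hL.integrable (by norm_num)) fun x => ?_)
    exact pow_le_of_le_one (hf0 y x) (hf1 y x) two_ne_zero
  exact (Finset.sum_le_sum fun y _ => h y).trans_eq (by simp)

/-- The subgaussian bound turns the sum over messages into `2 σ²` times the entropy of the message,
which is at most `log |Y|`. -/
theorem channelInfoBound_of_subgaussian (hdens : DensitiesExist p α φ)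
    (horth : OrthonormalPerturbations p φ) {σ : ℝ≥0} (hσ : SubgaussianIndep p φ σ) :
    ChannelInfoBound Y p φ (2 * σ ^ 2 * Real.log (Fintype.card Y)) := by
  intro z f hf hf0 hf1 hsum
  have hφ := memLp_two_of_orthonormal (fun j => (hdens z j).2.1) (horth z)
  have hw0 : ∀ y, 0 ≤ ∫ x, f y x ∂p z := fun y => integral_nonneg (hf0 y)
  have hw1 : ∑ y, ∫ x, f y x ∂p z = 1 := by
    rw [← integral_finsetSum _ fun y _ =>
      (memLp_two_of_mem_Icc (hf y) (hf0 y) (hf1 y)).integrable (by norm_num)]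
    simp [hsum]
  have hY : Nonempty Y := by
    by_contra h
    rw [not_nonempty_iff] at h
    simp at hw1
  have h : ∀ y, (∑ i, (∫ x, φ z i x * f y x ∂p z) ^ 2) / ∫ x, f y x ∂p z ≤
      2 * σ ^ 2 * Real.negMulLog (∫ x, f y x ∂p z) := by
    intro y
    rcases (hw0 y).eq_or_lt with h0 | h0
    · rw [← h0]
      simp
    · rw [div_le_iff₀ h0]
      refine (sum_sq_integral_mul_le_of_subgaussian hφ (hσ z).1 (hf y) (hf0 y) (hf1 y)
        h0).trans_eq ?_
      rw [Real.negMulLog, NNReal.coe_pow]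
      ring
  refine (Finset.sum_le_sum fun y _ => h y).trans ?_
  rw [← Finset.mul_sum]
  exact mul_le_mul_of_nonneg_left (sum_negMulLog_le_log_card _ hw0 hw1) (by positivity)

end Perturbation

/-! ### Bounds for protocols -/

namespace SeqProtocol

variable {X Y U : Type*} [MeasurableSpace X] [MeasurableSpace Y] [MeasurableSpace U]
  [DiscreteMeasurableSpace Y]
  {n k : ℕ} {V : Fin n → Type*} [∀ t, MeasurableSpace (V t)]
  {𝒲 : (t : Fin n) → Set (Channel X Y t)} (P : SeqProtocol X Y U V 𝒲)

theorem memLp_avgChannel (μ : Measure X) [IsProbabilityMeasure μ] (u : U) (t : Fin n)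
    (h : Fin (t : ℕ) → Y) (y : Y) : MemLp (fun x => (P.avgChannel u t h y x).toReal) 2 μ :=
  memLp_two_of_mem_Icc (P.measurable_avgChannel u t h y).ennreal_toReal
    (fun _ => ENNReal.toReal_nonneg) (P.toReal_avgChannel_le_one u t h y)

theorem stepProb_eq_zero_of_absolutelyContinuous {μ ν : Measure X} [IsProbabilityMeasure μ]
    (hνμ : ν ≪ μ) (u : U) (t : Fin n) (h : Fin (t : ℕ) → Y) (y : Y)
    (h0 : P.stepProb μ u t h y = 0) : P.stepProb ν u t h y = 0 := by
  rw [stepProb, integral_eq_zero_iff_of_nonneg (fun _ => ENNReal.toReal_nonneg)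
    (P.integrable_avgChannel μ u t h y)] at h0
  exact integral_eq_zero_of_ae (hνμ.ae_le h0)

variable [Fintype Y] {p : Cube k → Measure X} [∀ z, IsProbabilityMeasure (p z)] {α : ℝ}
  {φ : Cube k → Fin k → X → ℝ}

theorem sum_chiSq_stepProb_le (hdens : DensitiesExist p α φ)
    (horth : OrthonormalPerturbations p φ) {C : ℝ} (hC : ChannelInfoBound Y p φ C)
    (z : Cube k) (u : U) (t : Fin n) (h : Fin (t : ℕ) → Y) :
    ∑ i, chiSq (P.stepProb (p z) u t h) (P.stepProb (p (flipSign z i)) u t h) ≤ α ^ 2 * C := by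
  have hb := hC z (fun y x => (P.avgChannel u t h y x).toReal)
    (fun y => (P.measurable_avgChannel u t h y).ennreal_toReal)
    (fun _ _ => ENNReal.toReal_nonneg) (P.toReal_avgChannel_le_one u t h)
    (P.sum_toReal_avgChannel u t h)
  refine le_trans ?_ (mul_le_mul_of_nonneg_left hb (sq_nonneg α))
  simp only [chiSq]
  rw [Finset.sum_comm, Finset.mul_sum]
  refine Finset.sum_le_sum fun y _ => ?_
  rw [Finset.sum_div, Finset.mul_sum]
  refine Finset.sum_le_sum fun i _ => ?_
  obtain ⟨a, ha, hint⟩ := hdens.exists_integral_flipSign_eq horth z i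
  have h1 : P.stepProb (p (flipSign z i)) u t h y - P.stepProb (p z) u t h y =
      a * ∫ x, φ z i x * (P.avgChannel u t h y x).toReal ∂p z := by
    rw [stepProb, hint _ (P.memLp_avgChannel (p z) u t h y), stepProb, add_sub_cancel_left]
  have h2 : a ^ 2 ≤ α ^ 2 := sq_le_sq' (neg_le_of_abs_le ha) (le_of_abs_le ha)
  rw [h1, mul_pow, mul_div_assoc]
  exact mul_le_mul_of_nonneg_right h2
    (div_nonneg (sq_nonneg _) (P.stepProb_nonneg (p z) u t h y))

theorem sum_sq_condTV_le (hdens : DensitiesExist p α φ)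
    (horth : OrthonormalPerturbations p φ) {C : ℝ} (hC : ChannelInfoBound Y p φ C)
    (z : Cube k) (u : U) :
    ∑ i, P.condTV (p z) (p (flipSign z i)) u ^ 2 ≤ 2 * (n * (α ^ 2 * C)) := by
  set S := P.stepProb (p z) u with hS
  have h1 : ∀ i, P.condTV (p z) (p (flipSign z i)) u ^ 2 ≤ 2 * ∑ y, seqProb S y *
      ∑ t, chiSq (S t (messagePrefix y t))
        (P.stepProb (p (flipSign z i)) u t (messagePrefix y t)) := fun i =>
    sq_half_sum_abs_seqProb_sub_le (P.stepProb_nonneg _ u) (P.stepProb_nonneg _ u)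
      (P.sum_stepProb _ u) (P.sum_stepProb _ u)
      (P.stepProb_eq_zero_of_absolutelyContinuous (hdens z i).1 u)
  refine (Finset.sum_le_sum fun i _ => h1 i).trans ?_
  rw [← Finset.mul_sum, Finset.sum_comm]
  refine mul_le_mul_of_nonneg_left ?_ zero_le_two
  calc ∑ y, ∑ i, seqProb S y * ∑ t, chiSq (S t (messagePrefix y t))
        (P.stepProb (p (flipSign z i)) u t (messagePrefix y t))
      = ∑ y, seqProb S y * ∑ t, ∑ i, chiSq (S t (messagePrefix y t))
          (P.stepProb (p (flipSign z i)) u t (messagePrefix y t)) := by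
        refine Finset.sum_congr rfl fun y _ => ?_
        rw [← Finset.mul_sum, Finset.sum_comm]
    _ ≤ ∑ y, seqProb S y * ∑ _t : Fin n, α ^ 2 * C := by
        refine Finset.sum_le_sum fun y _ => mul_le_mul_of_nonneg_left
          (Finset.sum_le_sum fun t _ => ?_) (seqProb_nonneg (P.stepProb_nonneg _ u) y)
        exact P.sum_chiSq_stepProb_le hdens horth hC z u t _
    _ = n * (α ^ 2 * C) := by
        rw [← Finset.sum_mul, sum_seqProb (P.sum_stepProb _ u)]
        simp

instance (μ : Measure X) [IsProbabilityMeasure μ] : IsProbabilityMeasure (P.jointLaw μ) := by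
  unfold jointLaw
  infer_instance

instance (μ : Measure X) [IsProbabilityMeasure μ] : IsProbabilityMeasure (P.transcriptLaw μ) :=
  Measure.isProbabilityMeasure_map (by fun_prop)

theorem sq_avgDiscrepancy_transcriptLaw_le {τ : ℝ} (hτ : 0 < τ) (hτ' : τ ≤ 1 / 2)
    (hdens : DensitiesExist p α φ) (horth : OrthonormalPerturbations p φ) {C : ℝ}
    (hC : ChannelInfoBound Y p φ C) :
    avgDiscrepancy τ (fun z => P.transcriptLaw (p z)) ^ 2 ≤ 4 / k * n * α ^ 2 * C := by
  refine (sq_avgDiscrepancy_le hτ hτ' _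
    (d := fun z i => ∫ u, P.condTV (p z) (p (flipSign z i)) u ∂P.pubLaw)
    (D := 2 * (n * (α ^ 2 * C)))
    (fun z i A hA => P.abs_transcriptLaw_real_sub_le (p z) (p (flipSign z i)) hA)
    fun z => ?_).trans_eq (by ring)
  have hm := fun i => P.memLp_condTV (p z) (p (flipSign z i))
  -- Jensen's inequality, in the form of a nonnegative variance.
  have hJ : ∀ i, (∫ u, P.condTV (p z) (p (flipSign z i)) u ∂P.pubLaw) ^ 2 ≤
      ∫ u, P.condTV (p z) (p (flipSign z i)) u ^ 2 ∂P.pubLaw := by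
    intro i
    have h := variance_nonneg (P.condTV (p z) (p (flipSign z i))) P.pubLaw
    rw [variance_eq_sub (hm i)] at h
    simpa using h
  refine (Finset.sum_le_sum fun i _ => hJ i).trans ?_
  rw [← integral_finsetSum _ fun i _ => (hm i).integrable_sq]
  refine (integral_mono (integrable_finsetSum _ fun i _ => (hm i).integrable_sq)
    (integrable_const _) fun u => P.sum_sq_condTV_le hdens horth hC z u).trans_eq ?_
  simp

theorem messageLaw_eq_map_transcriptLaw (μ : Measure X) [IsProbabilityMeasure μ] :
    P.messageLaw μ = (P.transcriptLaw μ).map Prod.fst := by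
  rw [messageLaw, transcriptLaw, Measure.map_map measurable_fst (by fun_prop)]
  rfl

theorem avgDiscrepancy_messageLaw_le (τ : ℝ) :
    avgDiscrepancy τ (fun z => P.messageLaw (p z)) ≤
      avgDiscrepancy τ (fun z => P.transcriptLaw (p z)) := by
  simp_rw [messageLaw_eq_map_transcriptLaw]
  exact avgDiscrepancy_map_le τ _ measurable_fst

end SeqProtocol

end

theorem mainTheorem7 {X Y U : Type*} [MeasurableSpace X] [MeasurableSpace U]
    [MeasurableSpace Y] [Fintype Y] [DiscreteMeasurableSpace Y]
    {n k : ℕ} (hk : 0 < k)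
    {V : Fin n → Type*} [∀ t, MeasurableSpace (V t)]
    (𝒲 : (t : Fin n) → Set (Channel X Y t)) (P : SeqProtocol X Y U V 𝒲)
    (τ : ℝ) (hτ : 0 < τ) (hτ' : τ ≤ 1 / 2)
    (p : Cube k → Measure X) [∀ z, IsProbabilityMeasure (p z)]
    (α : ℝ) (φ : Cube k → Fin k → X → ℝ)
    (hdens : DensitiesExist p α φ) (horth : OrthonormalPerturbations p φ) :
    (avgDiscrepancy τ (fun z => P.messageLaw (p z)) ^ 2
        ≤ 7 / (k : ℝ) * n * α ^ 2 * Fintype.card Y ∧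
      avgDiscrepancy τ (fun z => P.transcriptLaw (p z)) ^ 2
        ≤ 7 / (k : ℝ) * n * α ^ 2 * Fintype.card Y) ∧
    ∀ σ : ℝ≥0, SubgaussianIndep p φ σ →
      avgDiscrepancy τ (fun z => P.messageLaw (p z)) ^ 2
        ≤ 14 * Real.log 2 / (k : ℝ) * n * α ^ 2 * (σ : ℝ) ^ 2 * Real.logb 2 (Fintype.card Y) ∧
      avgDiscrepancy τ (fun z => P.transcriptLaw (p z)) ^ 2
        ≤ 14 * Real.log 2 / (k : ℝ) * n * α ^ 2 * (σ : ℝ) ^ 2 * Real.logb 2 (Fintype.card Y) := by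
  have hmsg := pow_le_pow_left₀ (avgDiscrepancy_nonneg τ _)
    (P.avgDiscrepancy_messageLaw_le (p := p) τ) 2
  have h1 : avgDiscrepancy τ (fun z => P.transcriptLaw (p z)) ^ 2
      ≤ 7 / (k : ℝ) * n * α ^ 2 * Fintype.card Y := by
    refine (P.sq_avgDiscrepancy_transcriptLaw_le hτ hτ' hdens horth
      (channelInfoBound_card hdens horth)).trans ?_
    gcongr
    norm_num
  refine ⟨⟨hmsg.trans h1, h1⟩, fun σ hσ => ?_⟩
  have h2 : avgDiscrepancy τ (fun z => P.transcriptLaw (p z)) ^ 2 ≤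
      14 * Real.log 2 / (k : ℝ) * n * α ^ 2 * (σ : ℝ) ^ 2 * Real.logb 2 (Fintype.card Y) := by
    refine (P.sq_avgDiscrepancy_transcriptLaw_le hτ hτ' hdens horth
      (channelInfoBound_of_subgaussian hdens horth hσ)).trans ?_
    have hlog : 0 ≤ Real.log (Fintype.card Y) := Real.log_natCast_nonneg _
    have hl2 : Real.log 2 ≠ 0 := (Real.log_pos one_lt_two).ne'
    calc 4 / (k : ℝ) * n * α ^ 2 * (2 * (σ : ℝ) ^ 2 * Real.log (Fintype.card Y))
        = 8 * ((n : ℝ) / k * α ^ 2 * (σ : ℝ) ^ 2 * Real.log (Fintype.card Y)) := by ring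
      _ ≤ 14 * ((n : ℝ) / k * α ^ 2 * (σ : ℝ) ^ 2 * Real.log (Fintype.card Y)) := by
          gcongr
          norm_num
      _ = _ := by
          rw [Real.logb]
          field_simp
  exact ⟨hmsg.trans h2, h2⟩
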